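/- Let $\mathcal M\subseteq\mathbb R^D$ be a smooth $d$-dimensional embedded submanifold (not necessarily closed or connected), equipped with the Riemannian metric induced by the Euclidean metric of $\mathbb R^D$, with its Riemannian volume measure $\mathrm dx'$ and its geodesic distance $\mathrm{dist}_{\mathcal M}$ (equal to $\infty$ between points that no path in $\mathcal M$ joins). Let $p:\mathcal M\to[0,\infty)$ be a probability density function with respect to the Riemannian volume, i.e. $p$ is measurable and $\int_{\mathcal M}p(x')\,\mathrm dx'=1$. For $z\in\mathbb R^D$ and $\delta\in\mathbb R$ let $$\varrho_{\mathcal N}(z,\delta)=\int_{\mathcal M}p(x')\,(2\pi)^{-D/2}e^{-D\delta}\exp\left(-\tfrac12\|z-x'\|^2e^{-2\delta}\right)\mathrm dx'$$ be the convolution of $p$ with the centred isotropic Gaussian on $\mathbb R^D$ with log standard deviation $\delta$. Let $x\in\mathcal M$ be such that $p$ is continuous at $x$, $p(x)>0$, and $$\int_{\mathcal M}p(x')\,\mathrm{dist}_{\mathcal M}(x,x')^2\,\mathrm dx'<\infty .$$ Then for every $\delta\in\mathbb R$ the integral defining $\varrho_{\mathcal N}(x,\delta)$ converges and is positive, the function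 $\delta\mapsto\log\varrho_{\mathcal N}(x,\delta)$ is differentiable on $\mathbb R$, and $$\lim_{\delta\to-\infty}\frac{\partial}{\partial\delta}\log\varrho_{\mathcal N}(x,\delta)=d-D .$$ -/

import Mathlib

open MeasureTheory Filter Topology Manifold
open scoped ENNReal ContDiff

noncomputable section

namespace FLIPD

/-- The Gaussian density on `ℝ^D` with mean `μ` and covariance `exp (2 δ) • I`,
i.e. with log standard deviation `δ`. -/
def gaussianDensity {D : ℕ} (z μ : EuclideanSpace ℝ (Fin D)) (δ : ℝ) : ℝ :=
  (2 * Real.pi) ^ (-(D : ℝ) / 2) * Real.exp (-(D : ℝ) * δ) *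
    Real.exp (-(1 / 2) * ‖z - μ‖ ^ 2 * Real.exp (-2 * δ))

section Submanifold

variable {d D : ℕ} {M : Set (EuclideanSpace ℝ (Fin D))}
  [ChartedSpace (EuclideanSpace ℝ (Fin d)) M]

/-- The norm of the Riemannian metric on `T_x M` induced by the Euclidean metric of `ℝ^D`:
the Euclidean norm of the image of a tangent vector under the differential of the inclusion. -/
abbrev inducedENorm (x : M) : ENorm (TangentSpace (𝓡 d) x) where
  enorm v :=
    let w : EuclideanSpace ℝ (Fin D) :=
      mfderiv (𝓡 d) (𝓡 D) (Subtype.val : M → EuclideanSpace ℝ (Fin D)) x v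
    ‖w‖ₑ

variable (d) in
/-- The geodesic distance on `M` of the induced Riemannian metric: the infimum of the lengths of
the `C^1` paths in `M` that join the two points (`∞` if there is none). -/
def geodesicEDist (x y : M) : ℝ≥0∞ :=
  letI : ∀ z : M, ENorm (TangentSpace (𝓡 d) z) := inducedENorm
  riemannianEDist (𝓡 d) x y

/-- The inverse of the chart `e`, as a parametrization by (part of) `ℝ^d` of a part of `M`,
with values in `ℝ^D`. -/
def chartParam (e : OpenPartialHomeomorph M (EuclideanSpace ℝ (Fin d)))
    (y : EuclideanSpace ℝ (Fin d)) : EuclideanSpace ℝ (Fin D) :=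
  (e.symm y : EuclideanSpace ℝ (Fin D))

/-- The matrix `g_ij` of the induced Riemannian metric in the chart `e`. -/
def metricMatrix (e : OpenPartialHomeomorph M (EuclideanSpace ℝ (Fin d)))
    (y : EuclideanSpace ℝ (Fin d)) : Matrix (Fin d) (Fin d) ℝ :=
  Matrix.of fun i j => inner ℝ
    (fderiv ℝ (chartParam e) y (EuclideanSpace.single i 1))
    (fderiv ℝ (chartParam e) y (EuclideanSpace.single j 1))

/-- The Riemannian volume on the domain of the chart `e`: the measure that is
`√(det g_ij) dy` in the coordinates given by `e`, extended by zero to `M`. -/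
def chartVolume (e : OpenPartialHomeomorph M (EuclideanSpace ℝ (Fin d))) : Measure M :=
  ((volume.restrict e.target).withDensity
    fun y => ENNReal.ofReal √((metricMatrix e y).det)).map e.symm

variable (d M) in
/-- The Riemannian volume measure of `M`, glued from its expressions in the smooth charts: these
agree on the overlaps of the chart domains, and the glued measure is the least measure that
dominates all of them. -/
def riemannianVolume : Measure M :=
  ⨆ e ∈ IsManifold.maximalAtlas (𝓡 d) ∞ M, chartVolume e

theorem chartVolume_apply [IsManifold (𝓡 d) ∞ M]
    (e : OpenPartialHomeomorph M (EuclideanSpace ℝ (Fin d))) {A : Set M} (hA : MeasurableSet A) :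
    chartVolume e A = ∫⁻ y in e.target ∩ e.symm ⁻¹' A,
      ENNReal.ofReal √((metricMatrix e y).det) := by
  have h1 : AEMeasurable e.symm (volume.restrict e.target) :=
    e.continuousOn_symm.aemeasurable e.open_target.measurableSet
  have h2 : NullMeasurableSet (e.symm ⁻¹' A) (volume.restrict e.target) :=
    h1.nullMeasurableSet_preimage hA
  rw [chartVolume, Measure.map_apply_of_aemeasurable (h1.mono_ac (withDensity_absolutelyContinuous _ _)) hA,
    withDensity_apply₀ _ h2, Measure.restrict_restrict₀ h2, Set.inter_comm]

theorem differentiableAt_chartParam [IsManifold (𝓡 d) ∞ M]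
    (hM : IsSmoothEmbedding (𝓡 d) (𝓡 D) ∞ (Subtype.val : M → EuclideanSpace ℝ (Fin D)))
    {e : OpenPartialHomeomorph M (EuclideanSpace ℝ (Fin d))}
    (he : e ∈ IsManifold.maximalAtlas (𝓡 d) ∞ M) {y} (hy : y ∈ e.target) :
    DifferentiableAt ℝ (chartParam e) y := by
  have h1 : ContMDiffAt (𝓡 d) (𝓡 d) ∞ e.symm y :=
    contMDiffOn_symm_of_mem_maximalAtlas he |>.contMDiffAt (e.open_target.mem_nhds hy)
  have h2 : ContMDiffAt (𝓡 d) (𝓡 D) ∞ (chartParam e) y :=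
    ContMDiffAt.comp y (hM.contMDiff.contMDiffAt) h1
  exact (contMDiffAt_iff_contDiffAt.1 h2).differentiableAt (by simp)

set_option linter.unusedSectionVars false in
/-- Change of variables for `√(det g_ij)`. -/
theorem metricMatrix_comp (e e' : OpenPartialHomeomorph M (EuclideanSpace ℝ (Fin d)))
    {y : EuclideanSpace ℝ (Fin d)} {f : EuclideanSpace ℝ (Fin d) → EuclideanSpace ℝ (Fin d)}
    {f' : EuclideanSpace ℝ (Fin d) →L[ℝ] EuclideanSpace ℝ (Fin d)}
    (hf : HasFDerivAt f f' y) (h : DifferentiableAt ℝ (chartParam e') (f y))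
    (heq : chartParam e =ᶠ[𝓝 y] chartParam e' ∘ f) :
    √((metricMatrix e y).det) = |f'.det| * √((metricMatrix e' (f y)).det) := by
  set b := (EuclideanSpace.basisFun (Fin d) ℝ).toBasis
  set J := LinearMap.toMatrix b b f'.toLinearMap with hJ
  have hb : ∀ i, b i = EuclideanSpace.single i (1 : ℝ) := by intro i; simp [b]
  have hfd : fderiv ℝ (chartParam e) y = (fderiv ℝ (chartParam e') (f y)).comp f' := by
    rw [heq.fderiv_eq]; exact (h.hasFDerivAt.comp y hf).fderiv
  have hcol : ∀ i, f' (EuclideanSpace.single i 1) = ∑ k, J k i • EuclideanSpace.single k (1 : ℝ) := by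
    intro i
    have := b.sum_repr (f' (b i))
    simp only [hb] at this
    rw [← this]
    refine Finset.sum_congr rfl fun k _ => ?_
    simp [hJ, LinearMap.toMatrix_apply, hb]
  have hG : metricMatrix e y = J.transpose * metricMatrix e' (f y) * J := by
    ext i j
    simp only [metricMatrix, Matrix.of_apply, hfd, ContinuousLinearMap.comp_apply, hcol, map_sum,
      map_smul, Matrix.mul_apply, Matrix.transpose_apply, sum_inner, inner_sum, inner_smul_left,
      inner_smul_right, Finset.sum_mul, Finset.mul_sum]
    refine Finset.sum_congr rfl fun k _ => Finset.sum_congr rfl fun l _ => ?_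
    simp only [conj_trivial, real_inner_comm]
    ring
  have hdet : f'.det = J.det := by
    rw [hJ, LinearMap.det_toMatrix]; try rfl
  rw [hG, Matrix.det_mul, Matrix.det_mul, Matrix.det_transpose, hdet,
    show J.det * (metricMatrix e' (f y)).det * J.det = J.det ^ 2 * (metricMatrix e' (f y)).det by ring,
    Real.sqrt_mul (sq_nonneg _), Real.sqrt_sq_eq_abs]

/-- The chart expressions of the Riemannian volume agree on overlaps. -/
theorem chartVolume_eq [IsManifold (𝓡 d) ∞ M]
    (hM : IsSmoothEmbedding (𝓡 d) (𝓡 D) ∞ (Subtype.val : M → EuclideanSpace ℝ (Fin D)))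
    {e e' : OpenPartialHomeomorph M (EuclideanSpace ℝ (Fin d))}
    (he : e ∈ IsManifold.maximalAtlas (𝓡 d) ∞ M) (he' : e' ∈ IsManifold.maximalAtlas (𝓡 d) ∞ M)
    {A : Set M} (hA : MeasurableSet A) (hAe : A ⊆ e.source) (hAe' : A ⊆ e'.source) :
    chartVolume e A = chartVolume e' A := by
  have key : ∀ (u : OpenPartialHomeomorph M (EuclideanSpace ℝ (Fin d))),
      MeasurableSet (u.target ∩ u.symm ⁻¹' A) := fun u => by
    have h := u.open_target.measurableSet.subtype_image
      (u.continuousOn_symm.domRestrict.measurable hA)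
    rw [Set.domRestrict_eq, Set.preimage_comp, Subtype.image_preimage_coe] at h
    exact h
  set f := e' ∘ e.symm with hf
  have himg : f '' (e.target ∩ e.symm ⁻¹' A) = e'.target ∩ e'.symm ⁻¹' A := by
    ext z
    constructor
    · rintro ⟨y, ⟨hy, hyA⟩, rfl⟩
      refine ⟨e'.map_source (hAe' hyA), ?_⟩
      simpa [hf, e'.left_inv (hAe' hyA)] using hyA
    · rintro ⟨hz, hzA⟩
      refine ⟨e (e'.symm z), ⟨e.map_source (hAe hzA), ?_⟩, ?_⟩
      · simpa [e.left_inv (hAe hzA)] using hzA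
      · simp [hf, e.left_inv (hAe hzA), e'.right_inv hz]
  have hinj : Set.InjOn f (e.target ∩ e.symm ⁻¹' A) := by
    rintro y ⟨hy, hyA⟩ z ⟨hz, hzA⟩ h
    exact e.symm.injOn hy hz (e'.injOn (hAe' hyA) (hAe' hzA) h)
  have hdiff : ∀ y ∈ e.target ∩ e.symm ⁻¹' A, DifferentiableAt ℝ f y := by
    rintro y ⟨hy, hyA⟩
    have h1 : ContMDiffAt (𝓡 d) (𝓡 d) ∞ e.symm y :=
      contMDiffOn_symm_of_mem_maximalAtlas he |>.contMDiffAt (e.open_target.mem_nhds hy)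
    have h2 : ContMDiffAt (𝓡 d) (𝓡 d) ∞ e' (e.symm y) :=
      contMDiffOn_of_mem_maximalAtlas he' |>.contMDiffAt (e'.open_source.mem_nhds (hAe' hyA))
    exact (contMDiffAt_iff_contDiffAt.1 (h2.comp y h1)).differentiableAt (by simp)
  rw [chartVolume_apply e hA, chartVolume_apply e' hA, ← himg,
    lintegral_image_eq_lintegral_abs_det_fderiv_mul _ (key e)
      (fun y hy => (hdiff y hy).hasFDerivAt.hasFDerivWithinAt) hinj]
  refine setLIntegral_congr_fun (key e) fun y hy => ?_
  have hfy : f y ∈ e'.target := e'.map_source (hAe' hy.2)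
  rw [← ENNReal.ofReal_mul (abs_nonneg _)]
  congr 1
  refine metricMatrix_comp e e' (hdiff y hy).hasFDerivAt (differentiableAt_chartParam hM he' hfy) ?_
  have : e.symm ⁻¹' e'.source ∈ 𝓝 y :=
    (e.continuousAt_symm hy.1).preimage_mem_nhds (e'.open_source.mem_nhds (hAe' hy.2))
  filter_upwards [this] with z hz
  simp [chartParam, hf, e'.left_inv hz]

/-- In every chart the Riemannian volume is `√(det g_ij) dy`. -/
theorem riemannianVolume_restrict [IsManifold (𝓡 d) ∞ M]
    (hM : IsSmoothEmbedding (𝓡 d) (𝓡 D) ∞ (Subtype.val : M → EuclideanSpace ℝ (Fin D)))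
    {e : OpenPartialHomeomorph M (EuclideanSpace ℝ (Fin d))}
    (he : e ∈ IsManifold.maximalAtlas (𝓡 d) ∞ M) :
    (riemannianVolume d M).restrict e.source = chartVolume e := by
  have hsupp : ∀ (u : OpenPartialHomeomorph M (EuclideanSpace ℝ (Fin d))) (A : Set M),
      MeasurableSet A → chartVolume u (A ∩ u.source) = chartVolume u A := by
    intro u A hA
    rw [chartVolume_apply u hA, chartVolume_apply u (hA.inter u.open_source.measurableSet)]
    congr 2
    ext y
    simp only [Set.mem_inter_iff, Set.mem_preimage]
    exact ⟨fun h => ⟨h.1, h.2.1⟩, fun h => ⟨h.1, h.2, u.map_target h.1⟩⟩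
  have hle : chartVolume e ≤ riemannianVolume d M := le_iSup₂_of_le e he le_rfl
  have hs := e.open_source.measurableSet
  let m : Measure M := chartVolume e + ((⊤ : ℝ≥0∞) • Measure.count).restrict e.sourceᶜ
  have hm : riemannianVolume d M ≤ m := by
    refine iSup₂_le fun u hu => Measure.le_iff.2 fun A hA => ?_
    by_cases hAe : A ⊆ e.source
    · have hA' := hA.inter u.open_source.measurableSet
      calc chartVolume u A = chartVolume u (A ∩ u.source) := (hsupp u A hA).symm
        _ = chartVolume e (A ∩ u.source) := chartVolume_eq hM hu he hA' Set.inter_subset_right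
            (Set.inter_subset_left.trans hAe)
        _ ≤ chartVolume e A := measure_mono Set.inter_subset_left
        _ ≤ m A := by simp [m]
    · obtain ⟨z, hz, hze⟩ := Set.not_subset.1 hAe
      have : (Measure.count (A ∩ e.sourceᶜ) : ℝ≥0∞) ≠ 0 := by
        rw [Ne, Measure.count_eq_zero_iff]
        exact Set.Nonempty.ne_empty ⟨z, hz, hze⟩
      have : m A = ⊤ := by
        simp only [m, Measure.add_apply, Measure.restrict_apply hA, Measure.smul_apply, smul_eq_mul,
          ENNReal.top_mul this, add_top]
      simp [this]
  ext A hA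
  rw [Measure.restrict_apply hA]
  refine le_antisymm ?_ ?_
  · refine (hm _).trans ?_
    have hA' := hA.inter hs
    simp only [m, Measure.add_apply, Measure.restrict_apply hA']
    rw [show A ∩ e.source ∩ e.sourceᶜ = ∅ by ext; simp]
    simpa using measure_mono Set.inter_subset_left
  · rw [← hsupp e A hA]
    exact hle _

/-- `p` is a probability density function with respect to the Riemannian volume of `M`. -/
structure IsProbabilityDensity (d : ℕ) {D : ℕ} {M : Set (EuclideanSpace ℝ (Fin D))}
    [ChartedSpace (EuclideanSpace ℝ (Fin d)) M] (p : M → ℝ) : Prop where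
  aemeasurable : AEMeasurable p (riemannianVolume d M)
  nonneg : ∀ x, 0 ≤ p x
  lintegral_eq_one : ∫⁻ x, ENNReal.ofReal (p x) ∂(riemannianVolume d M) = 1

variable (d) in
/-- The convolution `ϱ_N(z, δ)` of the density `p` on `M` with the centred Gaussian on `ℝ^D`
with log standard deviation `δ`. -/
def gaussianConvolution (p : M → ℝ) (z : EuclideanSpace ℝ (Fin D)) (δ : ℝ) : ℝ :=
  ∫ x', p x' * gaussianDensity (z - (x' : EuclideanSpace ℝ (Fin D))) 0 δ
    ∂(riemannianVolume d M)

end Submanifold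

end FLIPD
end

open FLIPD

/-! Put `n = exp (-δ)` and let `r` be the Euclidean distance from `x` to `x'`. Up to a constant, the
convolution is `exp (-D δ)` times the moment generating function, at `n ^ 2`, of `-r ^ 2 / 2` under
the probability measure with density `p`. Its logarithmic derivative in `δ` is therefore `-D` plus
the quotient of `∫ p · (n r) ^ 2 · exp (-(n r) ^ 2 / 2)` by `∫ p · exp (-(n r) ^ 2 / 2)`
(`hasDerivAt_log_gaussianConvolution`), and the quotient has to tend to `d` as `n → ∞`.

After multiplication by `n ^ d`, both integrals are governed by Laplace's method
(`tendsto_pow_mul_integral_comp_sq_norm_sub`). In a chart whose inverse has injective derivative `A`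
at the base point, the substitution `y = y₀ + u / n` turns `n r` into `‖A u‖` in the limit. Both
limits carry the same factor, the volume density times `p x`, so the quotient tends to the second
moment of the Gaussian `exp (-‖A u‖ ^ 2 / 2)` divided by its mass. This is `d` for every injective
`A` (`integral_sq_norm_apply_mul_exp`). -/

namespace FLIPD

/-! ### Lower bounds from an injective derivative -/

section Injective

variable {E F : Type*} [NormedAddCommGroup E] [NormedSpace ℝ E] [FiniteDimensional ℝ E]
  [NormedAddCommGroup F] [NormedSpace ℝ F]

theorem exists_pos_mul_norm_le_norm_apply {A : E →L[ℝ] F} (hA : Function.Injective A) :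
    ∃ c : ℝ, 0 < c ∧ ∀ u, c * ‖u‖ ≤ ‖A u‖ := by
  obtain ⟨K, hK, h⟩ := (A : E →ₗ[ℝ] F).exists_antilipschitzWith (LinearMap.ker_eq_bot.2 hA)
  have hK' : (0 : ℝ) < K := hK
  refine ⟨(K : ℝ)⁻¹, inv_pos.2 hK', fun u => ?_⟩
  rw [inv_mul_le_iff₀ hK']
  simpa using h.le_mul_dist u 0

/-- The linear part expands by at least `c`, and near `y₀` the remainder uses up at most half of
that. -/
theorem exists_pos_eventually_mul_norm_sub_le {φ : E → F} {A : E →L[ℝ] F} {y₀ : E}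
    (hφ : HasFDerivAt φ A y₀) (hA : Function.Injective A) :
    ∃ c : ℝ, 0 < c ∧ ∀ᶠ y in 𝓝 y₀, c * ‖y - y₀‖ ≤ ‖φ y - φ y₀‖ := by
  obtain ⟨c, hc, h⟩ := exists_pos_mul_norm_le_norm_apply hA
  refine ⟨c / 2, half_pos hc, ?_⟩
  filter_upwards [hφ.isLittleO.def (half_pos hc)] with y hy
  have h1 := h (y - y₀)
  have h2 := norm_sub_norm_le (A (y - y₀)) (A (y - y₀) - (φ y - φ y₀))
  rw [sub_sub_cancel, norm_sub_rev (A (y - y₀)) (φ y - φ y₀)] at h2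
  linarith

end Injective

/-! ### Laplace's method and Gaussian moments on a Euclidean space -/

section Laplace

variable {E F : Type*} [NormedAddCommGroup E] [InnerProductSpace ℝ E] [FiniteDimensional ℝ E]
  [MeasurableSpace E] [BorelSpace E] [NormedAddCommGroup F] [NormedSpace ℝ F]

theorem integrable_exp_neg_mul_sq_norm {b : ℝ} (hb : 0 < b) :
    Integrable fun u : E => Real.exp (-b * ‖u‖ ^ 2) := by
  have h := (GaussianFourier.integrable_cexp_neg_mul_sq_norm_add (V := E) (b := (b : ℂ))
    (by simpa using hb) 0 0).norm
  refine h.congr (Eventually.of_forall fun u => ?_)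
  simp only [zero_mul, add_zero, Complex.norm_exp]
  congr 1
  have : (-(b : ℂ) * (‖u‖ : ℂ) ^ 2) = ((-b * ‖u‖ ^ 2 : ℝ) : ℂ) := by push_cast; ring
  rw [this, Complex.ofReal_re]

/-- Laplace's method for a quadratic phase `‖φ y - φ y₀‖ ^ 2` around a point where `φ` is
differentiable and expands distances by at least a positive factor. -/
theorem tendsto_pow_mul_setIntegral_comp_sq_norm_sub {φ : E → F} {A : E →L[ℝ] F} {y₀ : E}
    (hφ : HasFDerivAt φ A y₀) {S : Set E} (hS : MeasurableSet S) (hS₀ : S ∈ 𝓝 y₀)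
    (hφc : ContinuousOn φ S) {c : ℝ} (hc : 0 < c)
    (hlow : ∀ y ∈ S, c * ‖y - y₀‖ ≤ ‖φ y - φ y₀‖) {q : E → ℝ}
    (hqm : AEStronglyMeasurable q (volume.restrict S)) (hq : ContinuousAt q y₀) {K : ℝ}
    (hK : ∀ y ∈ S, |q y| ≤ K) {h : ℝ → ℝ} (hh : Continuous h) {C : ℝ}
    (hC : ∀ s, 0 ≤ s → |h s| ≤ C * Real.exp (-s / 4)) :
    Tendsto (fun n : ℝ => n ^ Module.finrank ℝ E *
        ∫ y in S, q y * h (n ^ 2 * ‖φ y - φ y₀‖ ^ 2)) atTop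
      (𝓝 (q y₀ * ∫ u, h (‖A u‖ ^ 2))) := by
  -- Extension by zero keeps the domain of integration fixed under the substitution `y = y₀ + n⁻¹ •
  -- u`, whose Jacobian accounts for the power of `n`.
  set f : ℝ → E → ℝ := fun n => S.indicator fun y => q y * h (n ^ 2 * ‖φ y - φ y₀‖ ^ 2) with hf
  have hK₀ : 0 ≤ K := (abs_nonneg _).trans (hK y₀ (mem_of_mem_nhds hS₀))
  have hC₀ : 0 ≤ C := by simpa using (abs_nonneg _).trans (hC 0 le_rfl)
  have hfm : ∀ n, AEStronglyMeasurable (f n) volume := fun n => by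
    rw [hf, aestronglyMeasurable_indicator_iff hS]
    refine hqm.mul (ContinuousOn.aestronglyMeasurable ?_ hS)
    exact hh.comp_continuousOn (continuousOn_const.mul ((hφc.sub continuousOn_const).norm.pow 2))
  have hEq : ∀ᶠ n : ℝ in atTop, ∫ u, f n (y₀ + n⁻¹ • u) = n ^ Module.finrank ℝ E *
      ∫ y in S, q y * h (n ^ 2 * ‖φ y - φ y₀‖ ^ 2) := by
    filter_upwards [eventually_gt_atTop 0] with n hn
    rw [Measure.integral_comp_inv_smul_of_nonneg volume (fun u => f n (y₀ + u)) hn.le,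
      integral_add_left_eq_self (f n) y₀, hf, integral_indicator hS, smul_eq_mul]
  refine Tendsto.congr' hEq ?_
  rw [← integral_const_mul]
  -- On `S` the expansion bound gives `n * ‖φ y - φ y₀‖ ≥ c * ‖u‖`, so the decay of `h` yields a
  -- Gaussian dominating function independent of `n`.
  refine tendsto_integral_filter_of_dominated_convergence
    (fun u => K * (C * Real.exp (-(c ^ 2 / 4) * ‖u‖ ^ 2))) ?_ ?_ ?_ ?_
  · filter_upwards [eventually_gt_atTop 0] with n hn
    exact ((hfm n).comp_quasiMeasurePreserving (quasiMeasurePreserving_add_left volume y₀)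
      ).comp_quasiMeasurePreserving
        (Measure.quasiMeasurePreserving_smul volume (inv_ne_zero hn.ne'))
  · filter_upwards [eventually_gt_atTop 0] with n hn
    refine Eventually.of_forall fun u => ?_
    by_cases hu : y₀ + n⁻¹ • u ∈ S
    · simp only [hf, Set.indicator_of_mem hu, norm_mul, Real.norm_eq_abs]
      refine mul_le_mul (hK _ hu) ((hC _ (by positivity)).trans ?_) (abs_nonneg _) hK₀
      refine mul_le_mul_of_nonneg_left (Real.exp_le_exp.2 ?_) hC₀
      have h1 := hlow _ hu
      rw [add_sub_cancel_left, norm_smul, norm_inv, Real.norm_of_nonneg hn.le] at h1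
      have h2 : c * ‖u‖ ≤ n * ‖φ (y₀ + n⁻¹ • u) - φ y₀‖ := by
        calc c * ‖u‖ = n * (c * (n⁻¹ * ‖u‖)) := by field_simp
          _ ≤ _ := mul_le_mul_of_nonneg_left h1 hn.le
      have h3 := pow_le_pow_left₀ (by positivity) h2 2
      rw [mul_pow, mul_pow] at h3
      linarith
    · simp only [hf, Set.indicator_of_notMem hu, norm_zero]
      positivity
  · exact ((integrable_exp_neg_mul_sq_norm (by positivity)).const_mul C).const_mul K
  · refine Eventually.of_forall fun u => ?_
    have hy : Tendsto (fun n : ℝ => y₀ + n⁻¹ • u) atTop (𝓝 y₀) := by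
      simpa using tendsto_const_nhds.add ((tendsto_inv_atTop_zero (𝕜 := ℝ)).smul_const u)
    -- The rescaled increment is a difference quotient in direction `u`.
    have hlim : Tendsto (fun n : ℝ => n • (φ (y₀ + n⁻¹ • u) - φ y₀)) atTop (𝓝 (A u)) :=
      hφ.lim u tendsto_norm_atTop_atTop
    have hh' : Tendsto (fun n : ℝ => h (‖n • (φ (y₀ + n⁻¹ • u) - φ y₀)‖ ^ 2)) atTop
        (𝓝 (h (‖A u‖ ^ 2))) := (hh.tendsto _).comp (hlim.norm.pow 2)
    refine ((hq.tendsto.comp hy).mul hh').congr' ?_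
    filter_upwards [hy hS₀] with n hn
    have hn' : y₀ + n⁻¹ • u ∈ S := hn
    simp only [hf, Set.indicator_of_mem hn', Function.comp_apply, norm_smul, mul_pow,
      Real.norm_eq_abs, sq_abs]

theorem integrable_exp_mul_neg_sq_norm_apply {A : E →L[ℝ] F} (hA : Function.Injective A)
    {t : ℝ} (ht : 0 < t) : Integrable fun u : E => Real.exp (t * (-(1 / 2) * ‖A u‖ ^ 2)) := by
  obtain ⟨c, hc, h⟩ := exists_pos_mul_norm_le_norm_apply hA
  refine (integrable_exp_neg_mul_sq_norm (E := E) (b := t / 2 * c ^ 2) (by positivity)).mono'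
    (by fun_prop) (Eventually.of_forall fun u => ?_)
  rw [Real.norm_of_nonneg (Real.exp_pos _).le, Real.exp_le_exp]
  have := pow_le_pow_left₀ (by positivity) (h u) 2
  rw [mul_pow] at this
  nlinarith

theorem integral_exp_neg_sq_norm_apply_pos {A : E →L[ℝ] F} (hA : Function.Injective A) :
    0 < ∫ u : E, Real.exp (-(‖A u‖ ^ 2) / 2) := by
  refine integral_exp_pos ?_
  refine (integrable_exp_mul_neg_sq_norm_apply hA one_pos).congr (Eventually.of_forall fun u => ?_)
  simp only []
  congr 1
  ring

/-- The second moment of a nondegenerate Gaussian in its own metric is the dimension. -/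
theorem integral_sq_norm_apply_mul_exp {A : E →L[ℝ] F} (hA : Function.Injective A) :
    ∫ u : E, ‖A u‖ ^ 2 * Real.exp (-(‖A u‖ ^ 2) / 2) =
      Module.finrank ℝ E * ∫ u : E, Real.exp (-(‖A u‖ ^ 2) / 2) := by
  set X : E → ℝ := fun u => -(1 / 2) * ‖A u‖ ^ 2 with hX
  set d := Module.finrank ℝ E
  have hint : (1 : ℝ) ∈ interior (ProbabilityTheory.integrableExpSet X volume) := by
    rw [mem_interior_iff_mem_nhds]
    filter_upwards [lt_mem_nhds one_pos] with t ht
    exact integrable_exp_mul_neg_sq_norm_apply hA ht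
  have hder := ProbabilityTheory.hasDerivAt_mgf hint
  -- The substitution `u ↦ r • u` makes this function constant near `r = 1`. Its vanishing
  -- derivative there, `d * mgf 1 + 2 * mgf' 1 = 0`, is the moment identity.
  have hscale : (fun r : ℝ => r ^ d * ProbabilityTheory.mgf X volume (r ^ 2)) =ᶠ[𝓝 1]
      fun _ => ProbabilityTheory.mgf X volume 1 := by
    filter_upwards [lt_mem_nhds one_pos] with r hr
    have h1 := Measure.integral_comp_smul (volume : Measure E)
      (fun u => Real.exp (1 * X u)) r
    have h2 : ∀ u, Real.exp (1 * X (r • u)) = Real.exp (r ^ 2 * X u) := fun u => by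
      simp only [hX, map_smul, norm_smul, mul_pow, Real.norm_eq_abs, sq_abs]
      congr 1
      ring
    simp only [h2] at h1
    rw [ProbabilityTheory.mgf, ProbabilityTheory.mgf, h1, smul_eq_mul, abs_of_pos (by positivity),
      mul_inv_cancel_left₀ (by positivity)]
  have hsq : HasDerivAt (fun r : ℝ => r ^ 2) 2 1 := by simpa using hasDerivAt_pow 2 (1 : ℝ)
  have hcomp : HasDerivAt (fun r : ℝ => ProbabilityTheory.mgf X volume (r ^ 2))
      ((∫ u, X u * Real.exp (1 * X u)) * 2) 1 :=
    HasDerivAt.comp (h₂ := ProbabilityTheory.mgf X volume) 1 (by simpa using hder) hsq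
  have hzero := ((hasDerivAt_pow d (1 : ℝ)).mul hcomp).unique
    ((hasDerivAt_const 1 _).congr_of_eventuallyEq hscale)
  have e1 : ProbabilityTheory.mgf X volume 1 = ∫ u : E, Real.exp (-(‖A u‖ ^ 2) / 2) :=
    integral_congr_ae (Eventually.of_forall fun u => by
      simp only [hX]
      congr 1
      ring)
  have e2 : (∫ u, X u * Real.exp (1 * X u)) * 2 =
      -∫ u : E, ‖A u‖ ^ 2 * Real.exp (-(‖A u‖ ^ 2) / 2) := by
    rw [← integral_mul_const, ← integral_neg]
    refine integral_congr_ae (Eventually.of_forall fun u => ?_)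
    simp only [hX]
    rw [show 1 * (-(1 / 2) * ‖A u‖ ^ 2) = -(‖A u‖ ^ 2) / 2 by ring]
    ring
  rw [e2] at hzero
  simp only [one_pow, mul_one, one_mul, e1] at hzero
  linarith

end Laplace

/-! ### Decay of the two kernels, positivity of the volume density -/

/-- Half of the exponent absorbs the factor `s`, since `1 + s / 4 ≤ exp (s / 4)`. The remaining
decay is shared with `exp (-s / 2)`, so one form of Laplace's method serves numerator and
denominator. -/
theorem mul_exp_neg_half_le {s : ℝ} (hs : 0 ≤ s) :
    |s * Real.exp (-s / 2)| ≤ 4 * Real.exp (-s / 4) := by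
  rw [abs_of_nonneg (by positivity), show -s / 2 = -s / 4 + -s / 4 by ring, Real.exp_add,
    ← mul_assoc]
  refine mul_le_mul_of_nonneg_right ?_ (Real.exp_pos _).le
  have h1 := Real.add_one_le_exp (s / 4)
  have h2 : Real.exp (s / 4) * Real.exp (-s / 4) = 1 := by
    rw [← Real.exp_add]; simp [neg_div]
  have h3 := Real.exp_pos (-s / 4)
  nlinarith

theorem exp_neg_half_le {s : ℝ} (hs : 0 ≤ s) :
    |Real.exp (-s / 2)| ≤ 1 * Real.exp (-s / 4) := by
  rw [abs_of_pos (Real.exp_pos _), one_mul, Real.exp_le_exp]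
  linarith

/-- The metric matrix is the Gram matrix of the images of the standard basis, which an injective map
keeps linearly independent. -/
theorem det_metricMatrix_pos {d D : ℕ} {M : Set (EuclideanSpace ℝ (Fin D))}
    {e : OpenPartialHomeomorph M (EuclideanSpace ℝ (Fin d))}
    {y : EuclideanSpace ℝ (Fin d)} (h : Function.Injective (fderiv ℝ (chartParam e) y)) :
    0 < (metricMatrix e y).det := by
  have hli : LinearIndependent ℝ
      fun i => fderiv ℝ (chartParam e) y (EuclideanSpace.single i (1 : ℝ)) := by
    have hb := (EuclideanSpace.basisFun (Fin d) ℝ).toBasis.linearIndependent.map'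
      (fderiv ℝ (chartParam e) y : EuclideanSpace ℝ (Fin d) →ₗ[ℝ] EuclideanSpace ℝ (Fin D))
      (LinearMap.ker_eq_bot.2 h)
    have hfun : (fun i => fderiv ℝ (chartParam e) y (EuclideanSpace.single i (1 : ℝ))) =
        fderiv ℝ (chartParam e) y ∘ (EuclideanSpace.basisFun (Fin d) ℝ).toBasis := by
      ext1 i
      simp
    rw [hfun]
    exact hb
  exact (Matrix.posDef_gram_of_linearIndependent hli).det_pos

/-! ### The submanifold in charts -/

section Submanifold

variable {d D : ℕ} {M : Set (EuclideanSpace ℝ (Fin D))}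
  [ChartedSpace (EuclideanSpace ℝ (Fin d)) M]

theorem contDiffOn_chartParam [IsManifold (𝓡 d) ∞ M]
    (hM : IsSmoothEmbedding (𝓡 d) (𝓡 D) ∞ (Subtype.val : M → EuclideanSpace ℝ (Fin D)))
    {e : OpenPartialHomeomorph M (EuclideanSpace ℝ (Fin d))}
    (he : e ∈ IsManifold.maximalAtlas (𝓡 d) ∞ M) : ContDiffOn ℝ ∞ (chartParam e) e.target :=
  contMDiffOn_iff_contDiffOn.1 <|
    hM.contMDiff.comp_contMDiffOn (contMDiffOn_symm_of_mem_maximalAtlas he)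

theorem continuousOn_det_metricMatrix [IsManifold (𝓡 d) ∞ M]
    (hM : IsSmoothEmbedding (𝓡 d) (𝓡 D) ∞ (Subtype.val : M → EuclideanSpace ℝ (Fin D)))
    {e : OpenPartialHomeomorph M (EuclideanSpace ℝ (Fin d))}
    (he : e ∈ IsManifold.maximalAtlas (𝓡 d) ∞ M) :
    ContinuousOn (fun y => (metricMatrix e y).det) e.target := by
  have h := (contDiffOn_chartParam hM he).continuousOn_fderiv_of_isOpen e.open_target (by simp)
  have hm : ContinuousOn (metricMatrix e) e.target :=
    continuousOn_pi.2 fun i => continuousOn_pi.2 fun j =>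
      ContinuousOn.inner (𝕜 := ℝ) (h.clm_apply continuousOn_const)
        (h.clm_apply continuousOn_const)
  exact (continuous_id.matrix_det).comp_continuousOn hm

/-- Around every point of a smoothly embedded manifold there is a chart whose inverse has
injective derivative there. -/
theorem exists_chart_injective_fderiv [IsManifold (𝓡 d) ∞ M]
    (hM : IsSmoothEmbedding (𝓡 d) (𝓡 D) ∞ (Subtype.val : M → EuclideanSpace ℝ (Fin D)))
    (x : M) : ∃ e ∈ IsManifold.maximalAtlas (𝓡 d) ∞ M, x ∈ e.source ∧
      Function.Injective (fderiv ℝ (chartParam e) (e x)) := by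
  have h := hM.isImmersion.isImmersionAt x
  refine ⟨h.domChart, h.domChart_mem_maximalAtlas, h.mem_domChart_source, ?_⟩
  set e := h.domChart
  set c := h.codChart
  have hx : e x ∈ e.target := e.map_source h.mem_domChart_source
  have hpx : chartParam e (e x) = x := by
    simp [chartParam, e.left_inv h.mem_domChart_source]
  have hφ := differentiableAt_chartParam hM h.domChart_mem_maximalAtlas hx
  have hc : DifferentiableAt ℝ c (chartParam e (e x)) := by
    rw [hpx]
    have := (contMDiffOn_of_mem_maximalAtlas h.codChart_mem_maximalAtlas).contMDiffAt
      (c.open_source.mem_nhds h.mem_codChart_source)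
    exact (contMDiffAt_iff_contDiffAt.1 this).differentiableAt (by simp)
  let L : EuclideanSpace ℝ (Fin d) →L[ℝ] EuclideanSpace ℝ (Fin D) :=
    h.equiv.toContinuousLinearMap.comp (ContinuousLinearMap.inl ℝ _ h.complement)
  -- In charts adapted to the immersion the inclusion is the injective linear map `L`. By the chain
  -- rule `L` factors through the derivative of `chartParam e`, which is then injective too.
  have hw : (fun y => c (chartParam e y)) =ᶠ[𝓝 (e x)] L := by
    filter_upwards [e.open_target.mem_nhds hx] with y hy
    have hy' : y ∈ (h.domChart.extend (𝓡 d)).target := by simpa using hy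
    exact h.writtenInCharts hy'
  have heq := (hc.hasFDerivAt.comp (e x) hφ.hasFDerivAt).unique (L.hasFDerivAt.congr_of_eventuallyEq hw)
  refine Function.Injective.of_comp (f := fderiv ℝ c (chartParam e (e x))) ?_
  rw [← ContinuousLinearMap.coe_comp, heq]
  intro u v huv
  simpa [L] using huv

theorem aemeasurable_sqrt_det_metricMatrix [IsManifold (𝓡 d) ∞ M]
    (hM : IsSmoothEmbedding (𝓡 d) (𝓡 D) ∞ (Subtype.val : M → EuclideanSpace ℝ (Fin D)))
    {e : OpenPartialHomeomorph M (EuclideanSpace ℝ (Fin d))}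
    (he : e ∈ IsManifold.maximalAtlas (𝓡 d) ∞ M) :
    AEMeasurable (fun y => ENNReal.ofReal √((metricMatrix e y).det))
      (volume.restrict e.target) :=
  (((continuousOn_det_metricMatrix hM he).sqrt).aemeasurable
    e.open_target.measurableSet).ennreal_ofReal

/-- Integration of a function over a part of a chart domain, in coordinates. -/
theorem setIntegral_riemannianVolume_eq [IsManifold (𝓡 d) ∞ M]
    (hM : IsSmoothEmbedding (𝓡 d) (𝓡 D) ∞ (Subtype.val : M → EuclideanSpace ℝ (Fin D)))
    {e : OpenPartialHomeomorph M (EuclideanSpace ℝ (Fin d))}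
    (he : e ∈ IsManifold.maximalAtlas (𝓡 d) ∞ M) {S : Set (EuclideanSpace ℝ (Fin d))}
    (hS : MeasurableSet S) (hSe : S ⊆ e.target) (hV : MeasurableSet (e.source ∩ e ⁻¹' S))
    {g : M → ℝ} (hg : AEMeasurable g (riemannianVolume d M)) :
    ∫ x in e.source ∩ e ⁻¹' S, g x ∂(riemannianVolume d M) =
      ∫ y in S, √((metricMatrix e y).det) * g (e.symm y) := by
  have h1 : AEMeasurable e.symm (volume.restrict e.target) :=
    e.continuousOn_symm.aemeasurable e.open_target.measurableSet
  have hg' : AEMeasurable g (chartVolume e) := by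
    rw [← riemannianVolume_restrict hM he]
    exact hg.restrict
  rw [← Set.inter_eq_self_of_subset_left
    (Set.inter_subset_left : e.source ∩ e ⁻¹' S ⊆ e.source), ← Measure.restrict_restrict hV,
    riemannianVolume_restrict hM he, ← integral_indicator hV, chartVolume,
    integral_map (h1.mono_ac (withDensity_absolutelyContinuous _ _))
      (hg'.aestronglyMeasurable.indicator hV),
    integral_withDensity_eq_integral_toReal_smul₀ (aemeasurable_sqrt_det_metricMatrix hM he)
      (Eventually.of_forall fun _ => ENNReal.ofReal_lt_top)]
  have hcongr : ∀ y ∈ e.target, (ENNReal.ofReal √((metricMatrix e y).det)).toReal •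
      (e.source ∩ e ⁻¹' S).indicator g (e.symm y) =
      S.indicator (fun y => √((metricMatrix e y).det) * g (e.symm y)) y := fun y hy => by
    rw [ENNReal.toReal_ofReal (Real.sqrt_nonneg _), smul_eq_mul]
    by_cases hyS : y ∈ S
    · rw [Set.indicator_of_mem hyS, Set.indicator_of_mem]
      exact ⟨e.map_target hy, by simpa [e.right_inv hy] using hyS⟩
    · rw [Set.indicator_of_notMem hyS, Set.indicator_of_notMem, mul_zero]
      exact fun h => hyS (by simpa [e.right_inv hy] using h.2)
  rw [setIntegral_congr_fun e.open_target.measurableSet hcongr, setIntegral_indicator hS,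
    Set.inter_eq_self_of_subset_right hSe]

/-- Almost everywhere measurability of `g` transfers at first only to the weighted measure `√(det
g_ij) dy`. Where the weight is positive, Lebesgue measure is absolutely continuous with respect to
it. -/
theorem aemeasurable_comp_chart_symm [IsManifold (𝓡 d) ∞ M]
    (hM : IsSmoothEmbedding (𝓡 d) (𝓡 D) ∞ (Subtype.val : M → EuclideanSpace ℝ (Fin D)))
    {e : OpenPartialHomeomorph M (EuclideanSpace ℝ (Fin d))}
    (he : e ∈ IsManifold.maximalAtlas (𝓡 d) ∞ M) {S : Set (EuclideanSpace ℝ (Fin d))}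
    (hS : MeasurableSet S) (hSe : S ⊆ e.target) (hpos : ∀ y ∈ S, 0 < (metricMatrix e y).det)
    {g : M → ℝ} (hg : AEMeasurable g (riemannianVolume d M)) :
    AEMeasurable (g ∘ e.symm) (volume.restrict S) := by
  have h1 : AEMeasurable e.symm (volume.restrict e.target) :=
    e.continuousOn_symm.aemeasurable e.open_target.measurableSet
  have hg' : AEMeasurable g (chartVolume e) := by
    rw [← riemannianVolume_restrict hM he]
    exact hg.restrict
  have h2 := AEMeasurable.comp_aemeasurable hg'
    (h1.mono_ac (withDensity_absolutelyContinuous _ _))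
  refine (h2.restrict (s := S)).mono_ac ?_
  rw [restrict_withDensity hS, Measure.restrict_restrict hS,
    Set.inter_eq_self_of_subset_left hSe]
  refine withDensity_absolutelyContinuous' ((aemeasurable_sqrt_det_metricMatrix hM he).mono_set hSe)
    ((ae_restrict_iff' hS).2 (Eventually.of_forall fun y hy => ?_))
  simpa using hpos y hy

/-- Laplace's method on an embedded submanifold, for a finite measure with a density that is
continuous at the base point. -/
theorem tendsto_pow_mul_integral_comp_sq_norm_sub [IsManifold (𝓡 d) ∞ M]
    (hM : IsSmoothEmbedding (𝓡 d) (𝓡 D) ∞ (Subtype.val : M → EuclideanSpace ℝ (Fin D)))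
    {e : OpenPartialHomeomorph M (EuclideanSpace ℝ (Fin d))}
    (he : e ∈ IsManifold.maximalAtlas (𝓡 d) ∞ M) {p : M → ℝ}
    (hp : Integrable p (riemannianVolume d M)) {x : M} (hx : x ∈ e.source)
    (hinj : Function.Injective (fderiv ℝ (chartParam e) (e x))) (hcont : ContinuousAt p x)
    {h : ℝ → ℝ} (hh : Continuous h) {C : ℝ}
    (hC : ∀ s, 0 ≤ s → |h s| ≤ C * Real.exp (-s / 4)) :
    Tendsto (fun n : ℝ => n ^ d *
        ∫ x' : M, p x' * h (n ^ 2 * ‖(x : EuclideanSpace ℝ (Fin D)) - x'‖ ^ 2)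
          ∂(riemannianVolume d M)) atTop
      (𝓝 (√((metricMatrix e (e x)).det) * p x *
        ∫ u, h (‖fderiv ℝ (chartParam e) (e x) u‖ ^ 2))) := by
  have hC₀ : 0 ≤ C := by simpa using (abs_nonneg _).trans (hC 0 le_rfl)
  have hy₀ : e x ∈ e.target := e.map_source hx
  have hφx : chartParam e (e x) = x := by simp [chartParam, e.left_inv hx]
  have hφ := (differentiableAt_chartParam hM he hy₀).hasFDerivAt
  obtain ⟨c, hc, hlow⟩ := exists_pos_eventually_mul_norm_sub_le hφ hinj
  have hdet := (continuousOn_det_metricMatrix hM he).continuousAt (e.open_target.mem_nhds hy₀)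
  set q : EuclideanSpace ℝ (Fin d) → ℝ := fun y => √((metricMatrix e y).det) * p (e.symm y)
  have hq : ContinuousAt q (e x) := by
    refine hdet.sqrt.mul (ContinuousAt.comp (g := p) ?_ (e.continuousAt_symm hy₀))
    rwa [e.left_inv hx]
  have hqK : ∀ᶠ y in 𝓝 (e x), |q y| < |q (e x)| + 1 :=
    hq.abs.eventually_lt continuousAt_const (lt_add_one _)
  -- One open set carries the expansion bound for the phase, the bound on the amplitude `q`, the
  -- positive determinant and the inclusion in the chart target.
  obtain ⟨S, hS, hSo, hxS⟩ := eventually_nhds_iff.1 <|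
    (hlow.and hqK).and ((hdet.eventually (lt_mem_nhds (det_metricMatrix_pos hinj))).and
      (e.open_target.mem_nhds hy₀))
  have hSe : S ⊆ e.target := fun y hy => (hS y hy).2.2
  have hVo : IsOpen (e.source ∩ e ⁻¹' S) := e.isOpen_inter_preimage hSo
  have hV : MeasurableSet (e.source ∩ e ⁻¹' S) := hVo.measurableSet
  -- `M` has the subspace topology, so points of `M` outside this neighbourhood stay at Euclidean
  -- distance at least `ε` from `x`, even when `M` is not closed.
  obtain ⟨ε, hε, hεV⟩ := Metric.isOpen_iff.1 hVo x ⟨hx, hxS⟩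
  have hhm : ∀ n : ℝ, Continuous fun x' : M =>
      h (n ^ 2 * ‖(x : EuclideanSpace ℝ (Fin D)) - x'‖ ^ 2) := fun n => by fun_prop
  have hint : ∀ n : ℝ, Integrable (fun x' : M =>
      p x' * h (n ^ 2 * ‖(x : EuclideanSpace ℝ (Fin D)) - x'‖ ^ 2)) (riemannianVolume d M) := by
    refine fun n => hp.mul_bdd (c := C) (hhm n).aestronglyMeasurable
      (Eventually.of_forall fun x' => (hC _ (by positivity)).trans ?_)
    refine mul_le_of_le_one_right hC₀ (Real.exp_le_one_iff.2 ?_)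
    have : 0 ≤ n ^ 2 * ‖(x : EuclideanSpace ℝ (Fin D)) - x'‖ ^ 2 := by positivity
    linarith
  have hnear := tendsto_pow_mul_setIntegral_comp_sq_norm_sub hφ hSo.measurableSet
    (hSo.mem_nhds hxS) ((contDiffOn_chartParam hM he).continuousOn.mono hSe) hc
    (fun y hy => (hS y hy).1.1) (q := q)
    (((((continuousOn_det_metricMatrix hM he).mono hSe).sqrt.aemeasurable hSo.measurableSet).mul
      (aemeasurable_comp_chart_symm hM he hSo.measurableSet hSe (fun y hy => (hS y hy).2.1)
        hp.1.aemeasurable)).aestronglyMeasurable) hq (fun y hy => (hS y hy).1.2.le) hh hC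
  rw [finrank_euclideanSpace_fin] at hnear
  have hfar : Tendsto (fun n : ℝ => n ^ d *
      ∫ x' in (e.source ∩ e ⁻¹' S)ᶜ, p x' *
        h (n ^ 2 * ‖(x : EuclideanSpace ℝ (Fin D)) - x'‖ ^ 2) ∂(riemannianVolume d M)) atTop
      (𝓝 0) := by
    set I := ∫ x', ‖p x'‖ ∂(riemannianVolume d M)
    have hlim : Tendsto (fun n : ℝ => n ^ d * Real.exp (-(ε ^ 2 / 4) * n) * (C * I)) atTop
        (𝓝 0) := by
      simpa using (tendsto_rpow_mul_exp_neg_mul_atTop_nhds_zero d (ε ^ 2 / 4)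
        (by positivity)).mul_const (C * I)
    refine squeeze_zero_norm' ?_ hlim
    -- For `n ≥ 1` the exponent `n ^ 2` may be weakened to `n`, which still beats the power `n ^ d`.
    filter_upwards [eventually_ge_atTop 1] with n hn
    rw [norm_mul, Real.norm_of_nonneg (by positivity), mul_assoc]
    refine mul_le_mul_of_nonneg_left ?_ (by positivity)
    calc _ ≤ ∫ x' in (e.source ∩ e ⁻¹' S)ᶜ,
          ‖p x'‖ * (C * Real.exp (-(ε ^ 2 / 4) * n)) ∂(riemannianVolume d M) := by
          refine norm_integral_le_of_norm_le (hp.norm.mul_const _).integrableOn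
            ((ae_restrict_iff' hV.compl).2 (Eventually.of_forall fun x' hx' => ?_))
          rw [norm_mul]
          refine mul_le_mul_of_nonneg_left ((hC _ (by positivity)).trans ?_) (norm_nonneg _)
          refine mul_le_mul_of_nonneg_left (Real.exp_le_exp.2 ?_) hC₀
          have hdist : ε ≤ ‖(x : EuclideanSpace ℝ (Fin D)) - x'‖ := by
            by_contra! hlt
            refine hx' (hεV ?_)
            rwa [Metric.mem_ball, dist_comm, Subtype.dist_eq, dist_eq_norm]
          have h1 := pow_le_pow_left₀ hε.le hdist 2
          have h2 : n * ε ^ 2 ≤ n ^ 2 * ‖(x : EuclideanSpace ℝ (Fin D)) - x'‖ ^ 2 :=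
            mul_le_mul (by nlinarith) h1 (by positivity) (by positivity)
          linarith
      _ ≤ ∫ x', ‖p x'‖ * (C * Real.exp (-(ε ^ 2 / 4) * n)) ∂(riemannianVolume d M) :=
          setIntegral_le_integral (hp.norm.mul_const _) (Eventually.of_forall fun x' => by
            dsimp only [Pi.zero_apply]; positivity)
      _ = _ := by rw [integral_mul_const]; ring
  have hsum := hnear.add hfar
  rw [add_zero] at hsum
  simp only [q, e.left_inv hx] at hsum
  refine hsum.congr fun n => ?_
  rw [← integral_add_compl hV (hint n), mul_add, setIntegral_riemannianVolume_eq hM he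
    hSo.measurableSet hSe hV (hint n).1.aemeasurable]
  congr 2
  refine setIntegral_congr_fun hSo.measurableSet fun y _ => ?_
  simp only [hφx]
  rw [norm_sub_rev, mul_assoc]
  rfl

/-! ### The Gaussian convolution as a moment generating function -/

variable {p : M → ℝ}

theorem IsProbabilityDensity.integrable (hp : IsProbabilityDensity d p) :
    Integrable p (riemannianVolume d M) := by
  refine ⟨hp.aemeasurable.aestronglyMeasurable, ?_⟩
  rw [hasFiniteIntegral_iff_ofReal (Eventually.of_forall hp.nonneg), hp.lintegral_eq_one]
  exact ENNReal.one_lt_top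

variable (d) in
/-- The measure on `M` with density `p` with respect to the Riemannian volume. -/
noncomputable def densityMeasure (p : M → ℝ) : Measure M :=
  (riemannianVolume d M).withDensity fun x => ENNReal.ofReal (p x)

theorem IsProbabilityDensity.isProbabilityMeasure (hp : IsProbabilityDensity d p) :
    IsProbabilityMeasure (densityMeasure d p) :=
  ⟨by rw [densityMeasure, withDensity_apply _ MeasurableSet.univ, Measure.restrict_univ,
    hp.lintegral_eq_one]⟩

theorem IsProbabilityDensity.integral_densityMeasure (hp : IsProbabilityDensity d p)
    (g : M → ℝ) : ∫ x, g x ∂(densityMeasure d p) = ∫ x, p x * g x ∂(riemannianVolume d M) := by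
  rw [densityMeasure, integral_withDensity_eq_integral_toReal_smul₀ hp.aemeasurable.ennreal_ofReal
    (Eventually.of_forall fun _ => ENNReal.ofReal_lt_top)]
  simp only [ENNReal.toReal_ofReal (hp.nonneg _), smul_eq_mul]

/-- The exponent of the Gaussian kernel centred at `z` of unit variance. -/
noncomputable def gaussianExponent (z : EuclideanSpace ℝ (Fin D)) (x : M) : ℝ :=
  -(1 / 2) * ‖z - x‖ ^ 2

theorem continuous_gaussianExponent (z : EuclideanSpace ℝ (Fin D)) :
    Continuous (gaussianExponent (M := M) z) := by
  unfold gaussianExponent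
  fun_prop

theorem gaussianExponent_nonpos (z : EuclideanSpace ℝ (Fin D)) (x : M) :
    gaussianExponent z x ≤ 0 := by
  have : 0 ≤ ‖z - (x : EuclideanSpace ℝ (Fin D))‖ ^ 2 := by positivity
  unfold gaussianExponent
  linarith

theorem integrable_exp_mul_gaussianExponent {μ : Measure M} [IsFiniteMeasure μ]
    (z : EuclideanSpace ℝ (Fin D)) {t : ℝ} (ht : 0 < t) :
    Integrable (fun x => Real.exp (t * gaussianExponent z x)) μ := by
  have hc : Continuous fun x : M => Real.exp (t * gaussianExponent z x) :=
    (continuous_const.mul (continuous_gaussianExponent z)).rexp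
  refine (integrable_const (1 : ℝ)).mono' hc.aestronglyMeasurable
    (Eventually.of_forall fun x => ?_)
  rw [Real.norm_of_nonneg (Real.exp_pos _).le]
  exact Real.exp_le_one_iff.2 (mul_nonpos_of_nonneg_of_nonpos ht.le (gaussianExponent_nonpos z x))

/-- For a nonpositive exponent and a finite measure, every positive parameter is interior to the set
of exponential integrability. -/
theorem hasDerivAt_mgf_gaussianExponent {μ : Measure M} [IsFiniteMeasure μ]
    (z : EuclideanSpace ℝ (Fin D)) {t : ℝ} (ht : 0 < t) :
    HasDerivAt (ProbabilityTheory.mgf (gaussianExponent z) μ)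
      (∫ x, gaussianExponent z x * Real.exp (t * gaussianExponent z x) ∂μ) t := by
  refine ProbabilityTheory.hasDerivAt_mgf (mem_interior_iff_mem_nhds.2 ?_)
  filter_upwards [lt_mem_nhds ht] with s hs
  exact integrable_exp_mul_gaussianExponent z hs

theorem gaussianDensity_sub_zero (z : EuclideanSpace ℝ (Fin D)) (x : M) (δ : ℝ) :
    gaussianDensity (z - (x : EuclideanSpace ℝ (Fin D))) 0 δ =
      (2 * Real.pi) ^ (-(D : ℝ) / 2) * Real.exp (-(D : ℝ) * δ) *
        Real.exp (Real.exp (-2 * δ) * gaussianExponent z x) := by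
  rw [gaussianDensity, gaussianExponent, sub_zero, mul_comm (Real.exp (-2 * δ))]

theorem IsProbabilityDensity.gaussianConvolution_eq (hp : IsProbabilityDensity d p)
    (z : EuclideanSpace ℝ (Fin D)) (δ : ℝ) : gaussianConvolution d p z δ =
      (2 * Real.pi) ^ (-(D : ℝ) / 2) * Real.exp (-(D : ℝ) * δ) *
        ProbabilityTheory.mgf (gaussianExponent z) (densityMeasure d p) (Real.exp (-2 * δ)) := by
  rw [ProbabilityTheory.mgf, hp.integral_densityMeasure, gaussianConvolution,
    ← integral_const_mul]
  refine integral_congr_ae (Eventually.of_forall fun x => ?_)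
  simp only [gaussianDensity_sub_zero]
  ring

theorem IsProbabilityDensity.mgf_pos (hp : IsProbabilityDensity d p)
    (z : EuclideanSpace ℝ (Fin D)) {t : ℝ} (ht : 0 < t) :
    0 < ProbabilityTheory.mgf (gaussianExponent z) (densityMeasure d p) t :=
  have := hp.isProbabilityMeasure
  ProbabilityTheory.mgf_pos (integrable_exp_mul_gaussianExponent z ht)

/-- The factor `exp (-D δ)` contributes `-D`. The rest is `mgf' / mgf` at `exp (-2 δ)`, written with
`exp (-δ) ^ 2` so that Laplace's method applies with `n = exp (-δ)`. -/
theorem IsProbabilityDensity.hasDerivAt_log_gaussianConvolution (hp : IsProbabilityDensity d p)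
    (z : EuclideanSpace ℝ (Fin D)) (δ : ℝ) :
    HasDerivAt (fun δ' => Real.log (gaussianConvolution d p z δ'))
      ((∫ x : M, p x * (Real.exp (-δ) ^ 2 * ‖z - x‖ ^ 2 *
          Real.exp (-(Real.exp (-δ) ^ 2 * ‖z - x‖ ^ 2) / 2)) ∂(riemannianVolume d M)) /
        (∫ x : M, p x * Real.exp (-(Real.exp (-δ) ^ 2 * ‖z - x‖ ^ 2) / 2)
          ∂(riemannianVolume d M)) - D) δ := by
  have := hp.isProbabilityMeasure
  set μ := densityMeasure d p
  set m := ProbabilityTheory.mgf (gaussianExponent z) μ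
  have hfun : (fun δ' => Real.log (gaussianConvolution d p z δ')) = fun δ' =>
      Real.log ((2 * Real.pi) ^ (-(D : ℝ) / 2)) + -(D : ℝ) * δ' +
        Real.log (m (Real.exp (-2 * δ'))) := by
    ext δ'
    have h1 : (2 * Real.pi) ^ (-(D : ℝ) / 2) ≠ 0 := by positivity
    rw [hp.gaussianConvolution_eq, Real.log_mul (by positivity)
      (hp.mgf_pos z (Real.exp_pos _)).ne', Real.log_mul h1 (Real.exp_pos _).ne', Real.log_exp]
  have ht : Real.exp (-2 * δ) = Real.exp (-δ) ^ 2 := by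
    rw [← Real.exp_nat_mul]
    congr 1
    push_cast
    ring
  have hexp : HasDerivAt (fun δ' : ℝ => Real.exp (-2 * δ')) (Real.exp (-2 * δ) * -2) δ := by
    simpa using ((hasDerivAt_id δ).const_mul (-2 : ℝ)).exp
  have hcomp := HasDerivAt.comp (h₂ := m) δ
    (hasDerivAt_mgf_gaussianExponent (μ := μ) z (Real.exp_pos (-2 * δ))) hexp
  have hlog := hcomp.log (hp.mgf_pos z (Real.exp_pos (-2 * δ))).ne'
  have hlin : HasDerivAt (fun δ' : ℝ => Real.log ((2 * Real.pi) ^ (-(D : ℝ) / 2)) + -(D : ℝ) * δ')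
      (-(D : ℝ)) δ := by
    simpa using ((hasDerivAt_id δ).const_mul (-(D : ℝ))).const_add
      (Real.log ((2 * Real.pi) ^ (-(D : ℝ) / 2)))
  have e1 : ∀ x : M, Real.exp (-2 * δ) * gaussianExponent z x =
      -(Real.exp (-δ) ^ 2 * ‖z - x‖ ^ 2) / 2 := fun x => by
    rw [ht, gaussianExponent]
    ring
  have e2 : (∫ x, gaussianExponent z x * Real.exp (Real.exp (-2 * δ) * gaussianExponent z x) ∂μ) *
      (Real.exp (-2 * δ) * -2) = ∫ x : M, p x * (Real.exp (-δ) ^ 2 * ‖z - x‖ ^ 2 *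
          Real.exp (-(Real.exp (-δ) ^ 2 * ‖z - x‖ ^ 2) / 2)) ∂(riemannianVolume d M) := by
    rw [← hp.integral_densityMeasure, ← integral_mul_const]
    refine integral_congr_ae (Eventually.of_forall fun x => ?_)
    simp only [e1]
    rw [ht, gaussianExponent]
    ring
  have e3 : m (Real.exp (-2 * δ)) = ∫ x : M, p x *
      Real.exp (-(Real.exp (-δ) ^ 2 * ‖z - x‖ ^ 2) / 2) ∂(riemannianVolume d M) := by
    rw [← hp.integral_densityMeasure]
    exact integral_congr_ae (Eventually.of_forall fun x => by simp only [e1])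
  rw [hfun]
  refine (hlin.add hlog).congr_deriv ?_
  rw [e2, Function.comp_apply, e3]
  ring

end Submanifold

end FLIPD

/-! ### The limit -/

theorem theorem1 {d D : ℕ} (M : Set (EuclideanSpace ℝ (Fin D)))
    [ChartedSpace (EuclideanSpace ℝ (Fin d)) M] [IsManifold (𝓡 d) ∞ M]
    (hM : IsSmoothEmbedding (𝓡 d) (𝓡 D) ∞ (Subtype.val : M → EuclideanSpace ℝ (Fin D)))
    (p : M → ℝ) (hp : IsProbabilityDensity d p)
    (x : M) (hcont : ContinuousAt p x) (hpos : 0 < p x)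
    (hmoment : ∫⁻ x', ENNReal.ofReal (p x') * geodesicEDist d x x' ^ 2
      ∂(riemannianVolume d M) < ⊤) :
    (∀ δ : ℝ, Integrable
      (fun x' : M => p x' * gaussianDensity ((x : EuclideanSpace ℝ (Fin D)) - (x' : EuclideanSpace ℝ (Fin D))) 0 δ)
      (riemannianVolume d M)) ∧
    (∀ δ : ℝ, 0 < gaussianConvolution d p x δ) ∧
    (∀ δ : ℝ, DifferentiableAt ℝ (fun δ' => Real.log (gaussianConvolution d p x δ')) δ) ∧
    Tendsto (fun δ : ℝ => deriv (fun δ' => Real.log (gaussianConvolution d p x δ')) δ)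
      atBot (𝓝 ((d : ℝ) - D)) := by

  have := hp.isProbabilityMeasure
  have hderiv := hp.hasDerivAt_log_gaussianConvolution (x : EuclideanSpace ℝ (Fin D))
  refine ⟨fun δ => ?_, fun δ => ?_, fun δ => (hderiv δ).differentiableAt, ?_⟩
  · have h := (integrable_withDensity_iff_integrable_smul₀' hp.aemeasurable.ennreal_ofReal
      (Eventually.of_forall fun _ => ENNReal.ofReal_lt_top)).1
      (integrable_exp_mul_gaussianExponent (μ := densityMeasure d p)
        (x : EuclideanSpace ℝ (Fin D)) (Real.exp_pos (-2 * δ)))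
    refine (h.const_mul ((2 * Real.pi) ^ (-(D : ℝ) / 2) * Real.exp (-(D : ℝ) * δ))).congr
      (Eventually.of_forall fun x' => ?_)
    simp only [gaussianDensity_sub_zero, ENNReal.toReal_ofReal (hp.nonneg _), smul_eq_mul]
    ring
  · rw [hp.gaussianConvolution_eq]
    exact mul_pos (by positivity) (hp.mgf_pos _ (Real.exp_pos _))
  · obtain ⟨e, he, hx, hinj⟩ := exists_chart_injective_fderiv hM x
    have hnum := tendsto_pow_mul_integral_comp_sq_norm_sub hM he hp.integrable hx hinj hcont
      (h := fun s => s * Real.exp (-s / 2)) (by fun_prop) fun s hs => mul_exp_neg_half_le hs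
    have hden := tendsto_pow_mul_integral_comp_sq_norm_sub hM he hp.integrable hx hinj hcont
      (h := fun s => Real.exp (-s / 2)) (by fun_prop) fun s hs => exp_neg_half_le hs
    rw [integral_sq_norm_apply_mul_exp hinj, finrank_euclideanSpace_fin] at hnum
    have hI := integral_exp_neg_sq_norm_apply_pos hinj
    have hg := Real.sqrt_pos.2 (det_metricMatrix_pos hinj)
    -- The denominator's limit is nonzero because `p x`, the volume density and the Gaussian
    -- integral are positive. The same factors cancel from the quotient and leave `d`.
    have hratio := hnum.div hden (by positivity)
    rw [mul_left_comm, mul_div_cancel_right₀ _ (by positivity)] at hratio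
    have hn : Tendsto (fun δ : ℝ => Real.exp (-δ)) atBot atTop :=
      Real.tendsto_exp_atTop.comp tendsto_neg_atBot_atTop
    refine ((hratio.comp hn).sub_const (D : ℝ)).congr fun δ => ?_
    rw [(hderiv δ).deriv, Function.comp_apply, Pi.div_apply,
      mul_div_mul_left _ _ (pow_pos (Real.exp_pos _) _).ne']
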